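/- **Theorem (Tilting Theorem).** Let $\mathcal{A}$ be an abelian category such that its (unbounded) derived category $\mathcal{D}(\mathcal{A})$ has Hom sets. For $m\in\mathbb{Z}$ let $\mathcal{D}^{\leq m}(\mathcal{A})$ be the full subcategory of $\mathcal{D}(\mathcal{A})$ of the complexes $X$ with $H^i(X)=0$ for all $i>m$. Let $\tau=(\mathcal{U},\mathcal{U}^{\perp}[1])$ be a $t$-structure on $\mathcal{D}(\mathcal{A})$, where $\mathcal{U}^{\perp}=\{X : \operatorname{Hom}_{\mathcal{D}(\mathcal{A})}(U,X)=0 \text{ for all } U\in\mathcal{U}\}$, such that $$\mathcal{D}^{\leq -n}(\mathcal{A})\subseteq\mathcal{U}\subseteq\mathcal{D}^{\leq 0}(\mathcal{A})$$ for some natural number $n\ge 0$, and let $\mathcal{H}_\tau=\mathcal{U}\cap\mathcal{U}^{\perp}[1]$ be its heart, which is an abelian category. Let $\mathcal{Y}=\mathcal{A}\cap\mathcal{H}_\tau$ be the class of the objects of $\mathcal{A}$ that lie in $\mathcal{H}_\tau$ when viewed as complexes concentrated in degree $0$. If $\mathcal{Y}$ is cogenerating in $\mathcal{A}$, that is, if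 for every object $X$ of $\mathcal{A}$ there is a monomorphism $X\to Y$ in $\mathcal{A}$ with $Y\in\mathcal{Y}$, then there is a triangulated equivalence $$F\colon\mathcal{D}(\mathcal{H}_\tau)\xrightarrow{\ \cong\ }\mathcal{D}(\mathcal{A})$$ whose restriction to $\mathcal{H}_\tau$ (the composition of $F$ with the functor $\mathcal{H}_\tau\to\mathcal{D}(\mathcal{H}_\tau)$ that views an object as a complex concentrated in degree $0$) is naturally isomorphic to the inclusion functor $\mathcal{H}_\tau\hookrightarrow\mathcal{D}(\mathcal{A})$. -/

import Mathlib

open CategoryTheory Limits Pretriangulated Triangulated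

universe w' w v u

namespace TiltingHeart

section Abelian

variable {C : Type u} [Category.{v} C] [Preadditive C] [HasZeroObject C] [HasShift C ℤ]
  [∀ n : ℤ, (shiftFunctor C n).Additive] [Pretriangulated C] (t : TStructure C)

/-- A zero object lies in the heart. -/
instance heart_containsZero : t.heart.ContainsZero where
  exists_zero := by
    obtain ⟨Z, hZ⟩ := HasZeroObject.zero (C := C)
    exact ⟨Z, hZ, (t.mem_heart_iff Z).2 ⟨t.isLE_of_isZero hZ 0, t.isGE_of_isZero hZ 0⟩⟩

/-- The heart is closed under extensions in the triangulated category. -/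
lemma heart_ext₂ (T : Triangle C) (hT : T ∈ distTriang C)
    (h₁ : t.heart T.obj₁) (h₃ : t.heart T.obj₃) : t.heart T.obj₂ := by
  rw [t.mem_heart_iff] at h₁ h₃ ⊢
  exact ⟨t.isLE₂ T hT 0 h₁.1 h₃.1, t.isGE₂ T hT 0 h₁.2 h₃.2⟩

/-- The heart is closed under binary products. -/
instance heart_closedUnderBinaryProducts : t.heart.IsClosedUnderBinaryProducts where
  limitsOfShape_le := by
    rintro X ⟨p⟩
    refine t.heart.prop_of_iso ?_ (heart_ext₂ t _ (binaryProductTriangle_distinguished _ _)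
      (p.prop_diag_obj (.mk .left)) (p.prop_diag_obj (.mk .right)))
    exact (limit.isLimit _).conePointUniqueUpToIso
      ((IsLimit.postcomposeHomEquiv (diagramIsoPair p.diag) _).symm p.isLimit)

/-- The heart is closed under finite products. -/
instance heart_closedUnderFiniteProducts :
    t.heart.IsClosedUnderFiniteProducts := .mk'

/-- There are no nonzero morphisms of negative degree between objects of the heart. -/
lemma heart_hom_neg ⦃X Y : t.heart.FullSubcategory⦄ ⦃n : ℤ⦄
    (f : t.heart.ι.obj X ⟶ (t.heart.ι.obj Y)⟦n⟧) (hn : n < 0) : f = 0 := by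
  have hX := ((t.mem_heart_iff _).1 X.property).1
  have hY := ((t.mem_heart_iff _).1 Y.property).2
  have : t.IsGE ((t.heart.ι.obj Y)⟦n⟧) (-n) :=
    @TStructure.isGE_shift _ _ _ _ _ _ _ t _ 0 n (-n) (by lia) hY
  exact t.zero_of_isLE_of_isGE f 0 (-n) (by lia) hX this

/-- Every morphism `f` of the heart is admissible: the truncation triangle of a cone of `f`
exhibits the kernel (up to shift) and the cokernel of `f`. -/
lemma heart_admissible :
    AbelianSubcategory.admissibleMorphism t.heart.ι = ⊤ := by
  ext X₁ X₂ f₁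
  simp only [MorphismProperty.top_apply, iff_true]
  intro X₃ f₂ f₃ hT
  have h₁ := (t.mem_heart_iff _).1 X₁.property
  have h₂ := (t.mem_heart_iff _).1 X₂.property
  have h₁LE : t.IsLE (X₁.obj⟦(1 : ℤ)⟧) (-1) :=
    @TStructure.isLE_shift _ _ _ _ _ _ _ t _ 0 1 (-1) (by lia) h₁.1
  have h₁GE : t.IsGE (X₁.obj⟦(1 : ℤ)⟧) (-1) :=
    @TStructure.isGE_shift _ _ _ _ _ _ _ t _ 0 1 (-1) (by lia) h₁.2
  have hLE : t.IsLE X₃ 0 := t.isLE₂ _ (rot_of_distTriang _ hT) 0 h₂.1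
    (@TStructure.isLE_of_le _ _ _ _ _ _ _ t _ (-1) 0 (by lia) h₁LE)
  have hGE : t.IsGE X₃ (-1) := t.isGE₂ _ (rot_of_distTriang _ hT) (-1)
    (@TStructure.isGE_of_ge _ _ _ _ _ _ _ t _ (-1) 0 (by lia) h₂.2) h₁GE
  obtain ⟨L, Q, hL, hQ, a, b, c, hT'⟩ := t.exists_triangle X₃ (-1) 0 (by lia)
  rw [t.le_iff_isLE] at hL
  rw [t.ge_iff_isGE] at hQ
  have hL' : t.IsGE L (-1) := t.isGE₂ _ (inv_rot_of_distTriang _ hT') (-1)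
    (@TStructure.isGE_of_ge _ _ _ _ _ _ _ t _ (-1) 1 (by lia)
      (@TStructure.isGE_shift _ _ _ _ _ _ _ t _ 0 (-1) 1 (by lia) hQ)) hGE
  have hQ' : t.IsLE Q 0 := t.isLE₂ _ (rot_of_distTriang _ hT') 0 hLE
    (@TStructure.isLE_of_le _ _ _ _ _ _ _ t _ (-2) 0 (by lia)
      (@TStructure.isLE_shift _ _ _ _ _ _ _ t _ (-1) 1 (-2) (by lia) hL))
  have hK : t.heart (L⟦(-1 : ℤ)⟧) := (t.mem_heart_iff _).2
    ⟨t.isLE_shift L (-1) (-1) 0 (by lia), t.isGE_shift L (-1) (-1) 0 (by lia)⟩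
  let e : (L⟦(-1 : ℤ)⟧)⟦(1 : ℤ)⟧ ≅ L := (shiftEquiv C (1 : ℤ)).counitIso.app L
  refine ⟨⟨_, hK⟩, ⟨Q, (t.mem_heart_iff _).2 ⟨hQ', hQ⟩⟩, e.hom ≫ a, b, c ≫ e.inv⟦(1 : ℤ)⟧', ?_⟩
  refine isomorphic_distinguished _ hT' _ ?_
  refine Triangle.isoMk _ _ e (Iso.refl _) (Iso.refl _) ?_ ?_ ?_
  · exact Category.comp_id _
  · exact (Category.comp_id _).trans (Category.id_comp _).symm
  · refine (Category.assoc _ _ _).trans ?_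
    have h : (shiftFunctor C (1 : ℤ)).map e.inv ≫ (shiftFunctor C (1 : ℤ)).map e.hom = 𝟙 _ := by
      rw [← Functor.map_comp, e.inv_hom_id, CategoryTheory.Functor.map_id]
    exact (congrArg (fun g ↦ c ≫ g) h).trans
      ((Category.comp_id c).trans (Category.id_comp c).symm)

/-- The heart of a t-structure on a triangulated category is an abelian category. Its additive
structure is the one it has as a full subcategory. -/
noncomputable instance heartAbelian [IsTriangulated C] : Abelian t.heart.FullSubcategory :=
  AbelianSubcategory.abelian t.heart.ι (heart_hom_neg t) (heart_admissible t)

end Abelian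

/-- A class `P` of objects of an abelian category is cogenerating if every object embeds
into an object of `P`. -/
def IsCogenerating {A : Type u} [Category.{v} A] (P : ObjectProperty A) : Prop :=
  ∀ X : A, ∃ (Y : A) (_ : P Y) (i : X ⟶ Y), Mono i

/-- The class `A ∩ H_τ` of the objects of `A` which, viewed as complexes concentrated in degree
zero, belong to the heart of the t-structure `τ` on the derived category of `A`. -/
def interHeart {A : Type u} [Category.{v} A] [Abelian A] [HasDerivedCategory.{w} A]
    (τ : TStructure (DerivedCategory A)) : ObjectProperty A :=
  fun X ↦ τ.heart ((DerivedCategory.singleFunctor A 0).obj X)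

end TiltingHeart

/-! Write `Y` for the common class of objects of `A` and of the heart `H`. Both derived categories
turn out to be the same Verdier quotient of the homotopy category `K(Y)` of unbounded complexes.

In `A`, every object embeds in an object of `Y`. If `X` lies in the `τ`-aisle shifted by `k + 1`,
the cokernel of such an embedding lies in the one shifted by `k`, so every object has a coresolution
by `Y` of length at most `n` (`coresolutionDimension`). In `H`, every object is a quotient of an
object of `Y`, and standard cohomological amplitude bounds resolutions by `n`
(`resolutionDimension`). The existence of these quotients is the delicate point:
`exists_single_triangle_of_isCogenerating` improves the truncation triangle of an object of `D^{≤0}`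
in `n` steps.

Finite dimension has two consequences without any boundedness of complexes. Every complex over `A`
(over `H`) is quasi-isomorphic to one over `Y`, so each derived category is a localization of
`K(Y)`. And an acyclic complex over `Y` has its cycles in `Y`. Since short exact sequences in `A`
and in `H` are detected by triangles of `D(A)`, acyclicity over `A` and over `H` agree
(`inverseImage_subcategoryAcyclic_eq`), which gives the equivalence.

It is the identity on `Y`, up to isomorphism. Finite resolutions by `Y` propagate this isomorphism
to all of `H` (`nonempty_iso_of_resolutionDimension`). -/

namespace TiltingHeart

/-! ### Verdier quotients restricted to a full triangulated subcategory -/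

section VerdierLocalization

variable {C D E : Type*} [Category* C] [Category* D] [Category* E]
  [HasZeroObject C] [HasShift C ℤ] [Preadditive C] [∀ n : ℤ, (shiftFunctor C n).Additive]
  [Pretriangulated C] [IsTriangulated C]
  [HasZeroObject D] [HasShift D ℤ] [Preadditive D] [∀ n : ℤ, (shiftFunctor D n).Additive]
  [Pretriangulated D] [IsTriangulated D]
  (F : C ⥤ D) [F.CommShift ℤ] [F.IsTriangulated] [F.Full] [F.Faithful]
  (N : ObjectProperty D) [N.IsTriangulated] [N.IsClosedUnderIsomorphisms]
  (L : D ⥤ E) [L.IsLocalization N.trW]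

lemma isLocalization_comp_of_isLocalizedFullyFaithful
    [(F.essImage.triangulatedLocalizerMorphism N).IsLocalizedFullyFaithful]
    (hL : (F ⋙ L).EssSurj) :
    (F ⋙ L).IsLocalization (N.inverseImage F).trW := by
  let Φ := F.essImage.triangulatedLocalizerMorphism N
  let G := Φ.localizedFunctor (N.inverseImage F.essImage.ι).trW.Q L
  let iso := CatCommSq.iso Φ.functor (N.inverseImage F.essImage.ι).trW.Q L G
  have : G.EssSurj := ⟨fun X ↦ by
    obtain ⟨Y, ⟨e⟩⟩ := hL.mem_essImage X
    exact ⟨(N.inverseImage F.essImage.ι).trW.Q.obj (F.toEssImage.obj Y),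
      ⟨(iso.app (F.toEssImage.obj Y)).symm ≪≫ e⟩⟩⟩
  have : G.IsEquivalence := {}
  have : Φ.IsLocalizedEquivalence := .mk' Φ (N.inverseImage F.essImage.ι).trW.Q L G
  have : (F.essImage.ι ⋙ L).IsLocalization (N.inverseImage F.essImage.ι).trW :=
    LocalizerMorphism.IsLocalizedEquivalence.isLocalization (L₂ := L) Φ
  have : F.toEssImage.IsEquivalence := {}
  refine Functor.IsLocalization.of_equivalence_source (F.essImage.ι ⋙ L)
    (N.inverseImage F.essImage.ι).trW _ _ F.toEssImage.asEquivalence.symm ?_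
    (ObjectProperty.inverseImage_trW_isInverted N F L)
    (Functor.isoWhiskerRight F.toEssImage.asEquivalence.counitIso (F.essImage.ι ⋙ L) ≪≫
      Functor.leftUnitor _)
  intro X Y f hf
  refine MorphismProperty.le_isoClosure _ _ ?_
  rw [ObjectProperty.inverseImage_trW_iff] at hf ⊢
  refine (N.trW.arrow_mk_iso_iff ?_).1 hf
  exact (F.essImage.ι.mapArrow.mapIso (Arrow.isoOfNatIso
    F.toEssImage.asEquivalence.counitIso (Arrow.mk f))).symm

lemma isLocalization_comp_of_right_resolutions
    (h : ∀ X : D, ∃ (Y : C) (s : X ⟶ F.obj Y), N.trW s) :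
    (F ⋙ L).IsLocalization (N.inverseImage F).trW := by
  -- A morphism from the image of `F` with cone in `N` is prolonged by a resolution of its target.
  -- The composite joins two objects of the image, so its cone lies in the image as well as in `N`.
  have : F.essImage.IsVerdierRightLocalizing N := by
    rw [ObjectProperty.isVerdierRightLocalizing_iff]
    intro X Y s hX hs
    obtain ⟨Z, b, hb⟩ := h Y
    have hs' := N.trW.comp_mem _ _ hs hb
    refine ⟨F.obj Z, s ≫ b, b, F.obj_mem_essImage Z, ?_, rfl⟩
    obtain ⟨U, c, d, hT⟩ := distinguished_cocone_triangle (s ≫ b)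
    exact ⟨U, c, d, hT, F.essImage.ext_of_isTriangulatedClosed₃ _ hT hX (F.obj_mem_essImage Z),
      (N.trW_iff_of_distinguished _ hT).1 hs'⟩
  have : L.EssSurj := Localization.essSurj L N.trW
  refine isLocalization_comp_of_isLocalizedFullyFaithful F N L ⟨fun X ↦ ?_⟩
  obtain ⟨Y, s, hs⟩ := h (L.objPreimage X)
  exact ⟨Y, ⟨(Localization.isoOfHom L N.trW s hs).symm ≪≫ L.objObjPreimageIso X⟩⟩

lemma isLocalization_comp_of_left_resolutions
    (h : ∀ X : D, ∃ (Y : C) (s : F.obj Y ⟶ X), N.trW s) :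
    (F ⋙ L).IsLocalization (N.inverseImage F).trW := by
  have : F.essImage.IsVerdierLeftLocalizing N := by
    rw [ObjectProperty.isVerdierLeftLocalizing_iff]
    intro X Y s hX hs
    obtain ⟨Z, b, hb⟩ := h X
    have hs' := N.trW.comp_mem _ _ hb hs
    refine ⟨F.obj Z, b ≫ s, b, F.obj_mem_essImage Z, ?_, rfl⟩
    obtain ⟨U, c, d, hT⟩ := distinguished_cocone_triangle (b ≫ s)
    exact ⟨U, c, d, hT, F.essImage.ext_of_isTriangulatedClosed₃ _ hT (F.obj_mem_essImage Z) hX,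
      (N.trW_iff_of_distinguished _ hT).1 hs'⟩
  have : L.EssSurj := Localization.essSurj L N.trW
  refine isLocalization_comp_of_isLocalizedFullyFaithful F N L ⟨fun X ↦ ?_⟩
  obtain ⟨Y, s, hs⟩ := h (L.objPreimage X)
  exact ⟨Y, ⟨Localization.isoOfHom L N.trW s hs ≪≫ L.objObjPreimageIso X⟩⟩

end VerdierLocalization

/-! ### Replacing unbounded complexes by complexes over `Y` -/

section Resolutions

open CochainComplex HomComplex

variable {Y B : Type*} [Category* Y] [Category* B] [Preadditive Y] [HasZeroObject Y]
  [HasBinaryBiproducts Y] [Abelian B] (j : Y ⥤ B) [j.Additive]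

/-- A filtration `dim 0, …, dim n` of the objects of `B` that behaves like the coresolution
dimension with respect to the essential image of `j`. -/
structure CoresolutionDimension (dim : ℕ → ObjectProperty B) (n : ℕ) : Prop where
  zero_le : dim 0 ≤ j.essImage
  step (k : ℕ) (S : ShortComplex B) (hS : S.ShortExact) (h₂ : j.essImage S.X₂)
    (h₁ : dim (k + 1) S.X₁) : dim k S.X₃
  top (X : B) : dim n X
  mono (X : B) : ∃ (M : Y) (i : X ⟶ j.obj M), Mono i

/-- A filtration `dim 0, …, dim n` of the objects of `B` that behaves like the resolution
dimension with respect to the essential image of `j`. -/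
structure ResolutionDimension (dim : ℕ → ObjectProperty B) (n : ℕ) : Prop where
  zero_le : dim 0 ≤ j.essImage
  step (k : ℕ) (S : ShortComplex B) (hS : S.ShortExact) (h₂ : j.essImage S.X₂)
    (h₃ : dim (k + 1) S.X₃) : dim k S.X₁
  top (X : B) : dim n X
  epi (X : B) : ∃ (M : Y) (p : j.obj M ⟶ X), Epi p

lemma exists_iso_map_of_essImage [j.Full] [j.Faithful] (K : CochainComplex B ℤ)
    (hK : ∀ i, j.essImage (K.X i)) :
    ∃ M : CochainComplex Y ℤ,
      Nonempty ((j.mapHomologicalComplex (ComplexShape.up ℤ)).obj M ≅ K) := by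
  choose X e using hK
  replace e := fun i ↦ (e i).some
  let M : CochainComplex Y ℤ :=
    { X := X
      d := fun i k ↦ j.preimage ((e i).hom ≫ K.d i k ≫ (e k).inv)
      shape := fun i k hik ↦ j.map_injective (by simp [K.shape _ _ hik])
      d_comp_d' := fun i k l _ _ ↦ j.map_injective (by simp) }
  exact ⟨M, ⟨HomologicalComplex.Hom.isoOfComponents (fun i ↦ e i) (fun i k _ ↦ by
    change _ = j.map (j.preimage _) ≫ (e k).hom
    rw [j.map_preimage, Category.assoc, Category.assoc, Iso.inv_hom_id, Category.comp_id]
    rfl)⟩⟩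

lemma isZero_quotient_map_mappingCone_id (M : CochainComplex Y ℤ) :
    IsZero ((HomotopyCategory.quotient B (ComplexShape.up ℤ)).obj
      ((j.mapHomologicalComplex _).obj (mappingCone (𝟙 M)))) := by
  have h := HomotopyCategory.mappingCone_triangleh_distinguished (𝟙 M)
  have : IsZero ((HomotopyCategory.quotient Y (ComplexShape.up ℤ)).obj (mappingCone (𝟙 M))) :=
    (Triangle.isZero₃_iff_isIso₁ _ h).2 (by
      change IsIso ((HomotopyCategory.quotient Y (ComplexShape.up ℤ)).map (𝟙 M))
      infer_instance)
  exact (j.mapHomotopyCategory (ComplexShape.up ℤ)).map_isZero this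

lemma exists_mono_map_mappingCone_id (h : ∀ X : B, ∃ (M : Y) (i : X ⟶ j.obj M), Mono i)
    (K : CochainComplex B ℤ) :
    ∃ (M : CochainComplex Y ℤ) (i : K ⟶ (j.mapHomologicalComplex _).obj (mappingCone (𝟙 M))),
      Mono i := by
  choose X a ha using fun i ↦ h (K.X i)
  let M : CochainComplex Y ℤ := { X := X, d := fun _ _ ↦ 0 }
  let φ := (j.mapHomologicalComplex (ComplexShape.up ℤ)).map (𝟙 M)
  let β : Cochain K ((j.mapHomologicalComplex (ComplexShape.up ℤ)).obj M) 0 :=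
    Cochain.ofHoms a
  -- The family `a` need not be a chain map; the summand `M[1]` of the cone absorbs its defect `δ
  -- β`.
  let α : Cocycle K ((j.mapHomologicalComplex (ComplexShape.up ℤ)).obj M) 1 :=
    Cocycle.mk (-δ 0 1 β) 2 (by simp) (by rw [δ_neg, δ_δ, neg_zero])
  let f : K ⟶ mappingCone φ := mappingCone.lift φ α β (by simp [α, φ])
  refine ⟨M, f ≫ (mappingCone.mapHomologicalComplexIso (𝟙 M) j).inv, ?_⟩
  have : Mono f := by
    have (i : ℤ) : Mono (f.f i) := by
      have h : f.f i ≫ (mappingCone.snd φ).v i i (add_zero i) = a i := by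
        simp only [f, mappingCone.lift_f_snd_v]
        exact Cochain.ofHoms_v _ _
      have : Mono (f.f i ≫ (mappingCone.snd φ).v i i (add_zero i)) := by
        rw [h]
        exact ha i
      exact mono_of_mono _ ((mappingCone.snd φ).v i i (add_zero i))
    exact HomologicalComplex.mono_of_mono_f f this
  infer_instance

lemma exists_epi_map_mappingCone_id (h : ∀ X : B, ∃ (M : Y) (p : j.obj M ⟶ X), Epi p)
    (K : CochainComplex B ℤ) :
    ∃ (M : CochainComplex Y ℤ) (p : (j.mapHomologicalComplex _).obj (mappingCone (𝟙 M)) ⟶ K),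
      Epi p := by
  choose X a ha using fun i ↦ h (K.X i)
  -- The index shift makes `X i` the summand `M.X (i + 1)` of the cone in degree `i`, where `inl`
  -- detects surjectivity.
  let M : CochainComplex Y ℤ := { X := fun i ↦ X (i - 1), d := fun _ _ ↦ 0 }
  let φ := (j.mapHomologicalComplex (ComplexShape.up ℤ)).map (𝟙 M)
  let α : Cochain ((j.mapHomologicalComplex (ComplexShape.up ℤ)).obj M) K (-1) :=
    Cochain.mk (fun p q hpq ↦ a (p - 1) ≫ (K.XIsoOfEq (by lia)).hom)
  let β : (j.mapHomologicalComplex (ComplexShape.up ℤ)).obj M ⟶ K :=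
    Cocycle.homOf (Cocycle.mk (δ (-1) 0 α) 1 (by simp) (by rw [δ_δ]))
  let f : mappingCone φ ⟶ K := mappingCone.desc φ α β (by simp [φ, β])
  refine ⟨M, (mappingCone.mapHomologicalComplexIso (𝟙 M) j).hom ≫ f, ?_⟩
  have : Epi f := by
    have (i : ℤ) : Epi (f.f i) := by
      have h : (mappingCone.inl φ).v (i + 1) i (by lia) ≫ f.f i =
          a (i + 1 - 1) ≫ (K.XIsoOfEq (by lia)).hom := by
        simp only [f, mappingCone.inl_v_desc_f]
        rfl
      have : Epi ((mappingCone.inl φ).v (i + 1) i (by lia) ≫ f.f i) := by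
        rw [h]
        have := ha (i + 1 - 1)
        exact epi_comp (a (i + 1 - 1)) (K.XIsoOfEq _).hom
      exact epi_of_epi ((mappingCone.inl φ).v (i + 1) i _) _
    exact HomologicalComplex.epi_of_epi_f f this
  infer_instance

variable {j}

lemma exists_trW_of_trW_shift {C D : Type*} [Category* C] [Category* D]
    [HasShift C ℤ] [HasZeroObject D] [HasShift D ℤ] [Preadditive D]
    [∀ n : ℤ, (CategoryTheory.shiftFunctor D n).Additive] [Pretriangulated D]
    (F : C ⥤ D) [F.CommShift ℤ] (N : ObjectProperty D) [N.IsStableUnderShift ℤ]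
    {X : D} {M : C} (t : X⟦(1 : ℤ)⟧ ⟶ F.obj M) (ht : N.trW t) :
    ∃ (M' : C) (s : X ⟶ F.obj M'), N.trW s := by
  refine ⟨M⟦(-1 : ℤ)⟧, (shiftShiftNeg X (1 : ℤ)).inv ≫ t⟦(-1 : ℤ)⟧' ≫
    (F.commShiftIso (-1 : ℤ)).inv.app M, ?_⟩
  exact (MorphismProperty.cancel_left_of_respectsIso N.trW _ _).2
    ((MorphismProperty.cancel_right_of_respectsIso N.trW _ _).2 (ht.shift (-1)))

lemma trW_quotient_map_descShortComplex {S : ShortComplex (CochainComplex B ℤ)}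
    (hS : S.ShortExact) :
    (HomotopyCategory.subcategoryAcyclic B).trW
      ((HomotopyCategory.quotient _ _).map (mappingCone.descShortComplex S)) := by
  rw [← HomotopyCategory.quasiIso_eq_trW_subcategoryAcyclic,
    HomotopyCategory.quotient_map_mem_quasiIso_iff, HomologicalComplex.mem_quasiIso_iff]
  exact mappingCone.quasiIso_descShortComplex hS

namespace CoresolutionDimension

variable {dim : ℕ → ObjectProperty B} {n : ℕ} (H : CoresolutionDimension j dim n)
  [j.Full] [j.Faithful]

include H

/-- Embed `K` in a contractible complex over `Y`. The cokernel has terms of dimension one less, and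
it is quasi-isomorphic to `K[1]`, because the cone of the embedding is `K[1]` up to homotopy. Induct
on `m` and shift back. -/
lemma exists_trW_of_dim (m : ℕ) (K : CochainComplex B ℤ) (hK : ∀ i, dim m (K.X i)) :
    ∃ (M : HomotopyCategory Y (ComplexShape.up ℤ))
      (s : (HomotopyCategory.quotient _ _).obj K ⟶ (j.mapHomotopyCategory _).obj M),
      (HomotopyCategory.subcategoryAcyclic B).trW s := by
  induction m generalizing K with
  | zero =>
    obtain ⟨M, ⟨e⟩⟩ := exists_iso_map_of_essImage j K (fun i ↦ H.zero_le _ (hK i))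
    exact ⟨(HomotopyCategory.quotient _ _).obj M, (HomotopyCategory.quotient _ _).map e.inv,
      ObjectProperty.trW_of_isIso _ ((HomotopyCategory.quotient _ _).mapIso e.symm).hom⟩
  | succ m hm =>
    obtain ⟨C, i, _⟩ := exists_mono_map_mappingCone_id j H.mono K
    let S := ShortComplex.mk i (cokernel.π i) (cokernel.condition i)
    have hS : S.ShortExact := { exact := S.exact_of_g_is_cokernel (cokernelIsCokernel i) }
    obtain ⟨M, s, hs⟩ := hm S.X₃ (fun k ↦
      H.step m _ (hS.map_of_exact (HomologicalComplex.eval B (ComplexShape.up ℤ) k))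
        (j.obj_mem_essImage _) (hK k))
    have hT := HomotopyCategory.mappingCone_triangleh_distinguished i
    have : IsIso (mappingCone.triangleh i).mor₃ :=
      (Triangle.isZero₂_iff_isIso₃ _ hT).1 (isZero_quotient_map_mappingCone_id j C)
    obtain ⟨t, ht⟩ : ∃ t : ((HomotopyCategory.quotient B (ComplexShape.up ℤ)).obj K)⟦(1 : ℤ)⟧ ⟶
        (j.mapHomotopyCategory (ComplexShape.up ℤ)).obj M,
        (HomotopyCategory.subcategoryAcyclic B).trW t :=
      ⟨_, (HomotopyCategory.subcategoryAcyclic B).trW.comp_mem _ _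
        (ObjectProperty.trW_of_isIso _ (inv (mappingCone.triangleh i).mor₃))
        ((HomotopyCategory.subcategoryAcyclic B).trW.comp_mem _ _
          (trW_quotient_map_descShortComplex hS) hs)⟩
    exact exists_trW_of_trW_shift (j.mapHomotopyCategory _) _ t ht

lemma exists_trW (K : HomotopyCategory B (ComplexShape.up ℤ)) :
    ∃ (M : HomotopyCategory Y (ComplexShape.up ℤ)) (s : K ⟶ (j.mapHomotopyCategory _).obj M),
      (HomotopyCategory.subcategoryAcyclic B).trW s := by
  obtain ⟨K, rfl⟩ := HomotopyCategory.quotient_obj_surjective K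
  exact H.exists_trW_of_dim n K (fun _ ↦ H.top _)

end CoresolutionDimension

namespace ResolutionDimension

variable {dim : ℕ → ObjectProperty B} {n : ℕ} (H : ResolutionDimension j dim n)
  [j.Full] [j.Faithful]

include H

lemma exists_trW_of_dim (m : ℕ) (K : CochainComplex B ℤ) (hK : ∀ i, dim m (K.X i)) :
    ∃ (M : HomotopyCategory Y (ComplexShape.up ℤ))
      (s : (j.mapHomotopyCategory _).obj M ⟶ (HomotopyCategory.quotient _ _).obj K),
      (HomotopyCategory.subcategoryAcyclic B).trW s := by
  induction m generalizing K with
  | zero =>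
    obtain ⟨M, ⟨e⟩⟩ := exists_iso_map_of_essImage j K (fun i ↦ H.zero_le _ (hK i))
    exact ⟨(HomotopyCategory.quotient _ _).obj M, (HomotopyCategory.quotient _ _).map e.hom,
      ObjectProperty.trW_of_isIso _ ((HomotopyCategory.quotient _ _).mapIso e).hom⟩
  | succ m hm =>
    obtain ⟨C, p, _⟩ := exists_epi_map_mappingCone_id j H.epi K
    let S := ShortComplex.mk (kernel.ι p) p (kernel.condition p)
    have hS : S.ShortExact := { exact := S.exact_of_f_is_kernel (kernelIsKernel p) }
    obtain ⟨M, s, hs⟩ := hm S.X₁ (fun k ↦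
      H.step m _ (hS.map_of_exact (HomologicalComplex.eval B (ComplexShape.up ℤ) k))
        (j.obj_mem_essImage _) (hK k))
    have hT := HomotopyCategory.mappingCone_triangleh_distinguished S.f
    have : IsIso (mappingCone.triangleh S.f).mor₃ :=
      (Triangle.isZero₂_iff_isIso₃ _ hT).1 (isZero_quotient_map_mappingCone_id j C)
    have h := (HomotopyCategory.subcategoryAcyclic B).trW.comp_mem _ _ (hs.shift 1)
      ((HomotopyCategory.subcategoryAcyclic B).trW.comp_mem _ _
        (ObjectProperty.trW_of_isIso _ (inv (mappingCone.triangleh S.f).mor₃))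
        (trW_quotient_map_descShortComplex hS))
    exact ⟨M⟦(1 : ℤ)⟧, ((j.mapHomotopyCategory (ComplexShape.up ℤ)).commShiftIso (1 : ℤ)).hom.app M
      ≫ _, (MorphismProperty.cancel_left_of_respectsIso _ _ _).2 h⟩

lemma exists_trW (K : HomotopyCategory B (ComplexShape.up ℤ)) :
    ∃ (M : HomotopyCategory Y (ComplexShape.up ℤ)) (s : (j.mapHomotopyCategory _).obj M ⟶ K),
      (HomotopyCategory.subcategoryAcyclic B).trW s := by
  obtain ⟨K, rfl⟩ := HomotopyCategory.quotient_obj_surjective K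
  exact H.exists_trW_of_dim n K (fun _ ↦ H.top _)

end ResolutionDimension

end Resolutions

/-! ### Acyclicity of complexes over `Y` in two abelian categories -/

section AcyclicTransfer

variable {B : Type*} [Category* B] [Abelian B]

lemma exists_shortExact_of_acyclic {K : CochainComplex B ℤ} (hK : K.Acyclic) :
    ∃ (Z : ℤ → B) (a : ∀ k, Z k ⟶ K.X k) (b : ∀ k, K.X k ⟶ Z (k + 1))
      (w : ∀ k, a k ≫ b k = 0), (∀ k, b k ≫ a (k + 1) = K.d k (k + 1)) ∧
      ∀ k, (ShortComplex.mk _ _ (w k)).ShortExact := by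
  let b (k : ℤ) : K.X k ⟶ kernel (K.d (k + 1) (k + 1 + 1)) :=
    kernel.lift _ (K.d k (k + 1)) (K.d_comp_d _ _ _)
  have fac (k : ℤ) : b k ≫ kernel.ι _ = K.d k (k + 1) := kernel.lift_ι _ _ _
  have w (k : ℤ) : kernel.ι (K.d k (k + 1)) ≫ b k = 0 := by
    rw [← cancel_mono (kernel.ι _), Category.assoc, fac, kernel.condition, zero_comp]
  refine ⟨fun k ↦ kernel (K.d k (k + 1)), fun k ↦ kernel.ι _, b, w, fac, fun k ↦ ?_⟩
  have h := (K.exactAt_iff' k (k + 1) (k + 1 + 1) (by simp) (by simp)).1 (hK (k + 1))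
  have : Epi (b k) := (ShortComplex.exact_iff_epi_kernel_lift _).1 h
  let S := ShortComplex.mk (kernel.ι (K.d k (k + 1))) (K.d k (k + 1)) (kernel.condition _)
  have hS : S.Exact := S.exact_of_f_is_kernel (kernelIsKernel _)
  let φ : ShortComplex.mk _ _ (w k) ⟶ S :=
    { τ₁ := 𝟙 _
      τ₂ := 𝟙 _
      τ₃ := kernel.ι _
      comm₁₂ := by simp [S]
      comm₂₃ := by simp [S, fac] }
  have : Epi φ.τ₁ := inferInstanceAs (Epi (𝟙 _))
  have : IsIso φ.τ₂ := inferInstanceAs (IsIso (𝟙 _))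
  have : Mono φ.τ₃ := inferInstanceAs (Mono (kernel.ι (K.d (k + 1) (k + 1 + 1))))
  exact { exact := (ShortComplex.exact_iff_of_epi_of_isIso_of_mono φ).2 hS }

lemma acyclic_of_shortExact {K : CochainComplex B ℤ} {Z : ℤ → B} (a : ∀ k, Z k ⟶ K.X k)
    (b : ∀ k, K.X k ⟶ Z (k + 1)) (w : ∀ k, a k ≫ b k = 0)
    (fac : ∀ k, b k ≫ a (k + 1) = K.d k (k + 1))
    (h : ∀ k, (ShortComplex.mk _ _ (w k)).ShortExact) : K.Acyclic := by
  intro k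
  obtain ⟨k, rfl⟩ : ∃ l, k = l + 1 := ⟨k - 1, by simp⟩
  rw [K.exactAt_iff' k (k + 1) (k + 1 + 1) (by simp) (by simp)]
  let S := ShortComplex.mk (K.d k (k + 1)) (b (k + 1)) (by
    have : Mono (a (k + 1 + 1)) := (h (k + 1 + 1)).mono_f
    rw [← cancel_mono (a (k + 1 + 1)), Category.assoc, fac, K.d_comp_d, zero_comp])
  let ψ : S ⟶ ShortComplex.mk _ _ (w (k + 1)) :=
    { τ₁ := b k
      τ₂ := 𝟙 _
      τ₃ := 𝟙 _
      comm₁₂ := by simp [S, fac]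
      comm₂₃ := by simp [S] }
  let χ : S ⟶ K.sc' k (k + 1) (k + 1 + 1) :=
    { τ₁ := 𝟙 _
      τ₂ := 𝟙 _
      τ₃ := a (k + 1 + 1)
      comm₁₂ := (Category.id_comp _).trans (Category.comp_id _).symm
      comm₂₃ := (Category.id_comp _).trans (fac _).symm }
  have : Epi ψ.τ₁ := (h k).epi_g
  have : IsIso ψ.τ₂ := inferInstanceAs (IsIso (𝟙 _))
  have : Mono ψ.τ₃ := inferInstanceAs (Mono (𝟙 _))
  have : Epi χ.τ₁ := inferInstanceAs (Epi (𝟙 _))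
  have : IsIso χ.τ₂ := inferInstanceAs (IsIso (𝟙 _))
  have : Mono χ.τ₃ := (h (k + 1 + 1)).mono_f
  exact (ShortComplex.exact_iff_of_epi_of_isIso_of_mono χ).1
    ((ShortComplex.exact_iff_of_epi_of_isIso_of_mono ψ).2 (h (k + 1)).exact)

variable {D : Type*} [Category* D] [HasZeroObject D] [HasShift D ℤ] [Preadditive D]
  [∀ n : ℤ, (shiftFunctor D n).Additive] [Pretriangulated D]

/-- The functor `ι` from an abelian category to a triangulated category identifies short
exact sequences with distinguished triangles. -/
def DetectsShortExact (ι : B ⥤ D) : Prop :=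
  ∀ S : ShortComplex B, S.ShortExact ↔
    ∃ δ : ι.obj S.X₃ ⟶ (ι.obj S.X₁)⟦(1 : ℤ)⟧, Triangle.mk (ι.map S.f) (ι.map S.g) δ ∈ distTriang D

variable {Y : Type*} [Category* Y] [Preadditive Y] {B' : Type*} [Category* B'] [Abelian B']
  {ι : B ⥤ D} {ι' : B' ⥤ D} (hι : DetectsShortExact ι) (hι' : DetectsShortExact ι')
  {j : Y ⥤ B} {j' : Y ⥤ B'} [j.Additive] [j'.Additive] (e : j ⋙ ι ≅ j' ⋙ ι')

include hι hι' e

lemma DetectsShortExact.map_shortExact (S : ShortComplex Y) (hS : (S.map j).ShortExact) :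
    (S.map j').ShortExact := by
  obtain ⟨δ, hδ⟩ := (hι _).1 hS
  refine (hι' _).2 ⟨e.inv.app S.X₃ ≫ δ ≫ (e.hom.app S.X₁)⟦(1 : ℤ)⟧', ?_⟩
  refine isomorphic_distinguished _ hδ _ (Iso.symm ?_)
  refine Triangle.isoMk _ _ (e.app _) (e.app _) (e.app _) ?_ ?_ ?_
  · exact e.hom.naturality S.f
  · exact e.hom.naturality S.g
  · exact (e.hom_inv_id_app_assoc S.X₃ _).symm

/-- Once the cycles lie in `Y`, full faithfulness lifts the whole splicing of the complex to `Y`,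
and its short exact pieces can be carried to the other abelian category one by one. -/
lemma DetectsShortExact.acyclic_map_of_shortExact [j.Full] [j.Faithful] (M : CochainComplex Y ℤ)
    (Z : ℤ → B) (hZ : ∀ k, j.essImage (Z k)) (a : ∀ k, Z k ⟶ j.obj (M.X k))
    (b : ∀ k, j.obj (M.X k) ⟶ Z (k + 1)) (w : ∀ k, a k ≫ b k = 0)
    (fac : ∀ k, b k ≫ a (k + 1) = j.map (M.d k (k + 1)))
    (h : ∀ k, (ShortComplex.mk _ _ (w k)).ShortExact) :
    ((j'.mapHomologicalComplex (ComplexShape.up ℤ)).obj M).Acyclic := by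
  choose Z' i using hZ
  replace i := fun k ↦ (i k).some
  let a' (k : ℤ) : Z' k ⟶ M.X k := j.preimage ((i k).hom ≫ a k)
  let b' (k : ℤ) : M.X k ⟶ Z' (k + 1) := j.preimage (b k ≫ (i (k + 1)).inv)
  have ha (k : ℤ) : j.map (a' k) = (i k).hom ≫ a k := j.map_preimage _
  have hb (k : ℤ) : j.map (b' k) = b k ≫ (i (k + 1)).inv := j.map_preimage _
  have w' (k : ℤ) : a' k ≫ b' k = 0 := j.map_injective (by
    rw [j.map_comp, ha, hb, Category.assoc, reassoc_of% w k, zero_comp, comp_zero, j.map_zero])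
  have fac' (k : ℤ) : b' k ≫ a' (k + 1) = M.d k (k + 1) := j.map_injective (by
    rw [j.map_comp, ha, hb, Category.assoc, Iso.inv_hom_id_assoc, fac])
  have hS (k : ℤ) : ((ShortComplex.mk _ _ (w' k)).map j).ShortExact := by
    refine ShortComplex.shortExact_of_iso (Iso.symm ?_) (h k)
    refine ShortComplex.isoMk (i k) (Iso.refl _) (i (k + 1)) ?_ ?_
    · exact (ha k).symm.trans (Category.comp_id _).symm
    · exact (Category.id_comp _).trans ((Iso.comp_inv_eq _).1 (hb k).symm)
  exact acyclic_of_shortExact (K := (j'.mapHomologicalComplex (ComplexShape.up ℤ)).obj M)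
    (fun k ↦ j'.map (a' k)) (fun k ↦ j'.map (b' k))
    (fun k ↦ (j'.map_comp _ _).symm.trans ((congrArg j'.map (w' k)).trans (j'.map_zero _ _)))
    (fun k ↦ (j'.map_comp _ _).symm.trans (congrArg j'.map (fac' k)))
    (fun k ↦ hι.map_shortExact hι' e _ (hS k))

omit hι hι' e

/-- Dimension shifting in an infinite sequence: all `Z l` have dimension at most `n`, and each is
the cokernel term of a sequence starting at its predecessor, so the bound drops by one for all `l`
at once. After `n` rounds it is zero. -/
lemma CoresolutionDimension.essImage_of_shortExact {dim : ℕ → ObjectProperty B} {n : ℕ}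
    (H : CoresolutionDimension j dim n) (Z X : ℤ → B) (hX : ∀ k, j.essImage (X k))
    (a : ∀ k, Z k ⟶ X k) (b : ∀ k, X k ⟶ Z (k + 1)) (w : ∀ k, a k ≫ b k = 0)
    (h : ∀ k, (ShortComplex.mk _ _ (w k)).ShortExact) (k : ℤ) : j.essImage (Z k) := by
  have h (m : ℕ) (hm : m ≤ n) : ∀ l, dim (n - m) (Z l) := by
    induction m with
    | zero => exact fun l ↦ H.top _
    | succ m hm' =>
      intro l
      obtain ⟨l, rfl⟩ : ∃ l', l = l' + 1 := ⟨l - 1, by simp⟩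
      exact H.step _ _ (h l) (hX l)
        (by simpa only [show n - (m + 1) + 1 = n - m by lia] using hm' (by lia) l)
  exact H.zero_le _ (by simpa using h n le_rfl k)

lemma ResolutionDimension.essImage_of_shortExact {dim : ℕ → ObjectProperty B} {n : ℕ}
    (H : ResolutionDimension j dim n) (Z X : ℤ → B) (hX : ∀ k, j.essImage (X k))
    (a : ∀ k, Z k ⟶ X k) (b : ∀ k, X k ⟶ Z (k + 1)) (w : ∀ k, a k ≫ b k = 0)
    (h : ∀ k, (ShortComplex.mk _ _ (w k)).ShortExact) (k : ℤ) : j.essImage (Z k) := by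
  have h (m : ℕ) (hm : m ≤ n) : ∀ l, dim (n - m) (Z l) := by
    induction m with
    | zero => exact fun l ↦ H.top _
    | succ m hm' =>
      intro l
      exact H.step _ _ (h l) (hX l)
        (by simpa only [show n - (m + 1) + 1 = n - m by lia] using hm' (by lia) (l + 1))
  exact H.zero_le _ (by simpa using h n le_rfl k)

include hι hι' e

lemma CoresolutionDimension.acyclic_map [j.Full] [j.Faithful] {dim : ℕ → ObjectProperty B} {n : ℕ}
    (H : CoresolutionDimension j dim n) (M : CochainComplex Y ℤ)
    (hM : ((j.mapHomologicalComplex (ComplexShape.up ℤ)).obj M).Acyclic) :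
    ((j'.mapHomologicalComplex (ComplexShape.up ℤ)).obj M).Acyclic := by
  obtain ⟨Z, a, b, w, fac, h⟩ := exists_shortExact_of_acyclic hM
  exact hι.acyclic_map_of_shortExact hι' e M Z
    (H.essImage_of_shortExact Z (fun k ↦ j.obj (M.X k)) (fun k ↦ j.obj_mem_essImage _) a b w h)
    a b w fac h

lemma ResolutionDimension.acyclic_map [j.Full] [j.Faithful] {dim : ℕ → ObjectProperty B} {n : ℕ}
    (H : ResolutionDimension j dim n) (M : CochainComplex Y ℤ)
    (hM : ((j.mapHomologicalComplex (ComplexShape.up ℤ)).obj M).Acyclic) :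
    ((j'.mapHomologicalComplex (ComplexShape.up ℤ)).obj M).Acyclic := by
  obtain ⟨Z, a, b, w, fac, h⟩ := exists_shortExact_of_acyclic hM
  exact hι.acyclic_map_of_shortExact hι' e M Z
    (H.essImage_of_shortExact Z (fun k ↦ j.obj (M.X k)) (fun k ↦ j.obj_mem_essImage _) a b w h)
    a b w fac h

end AcyclicTransfer

/-! ### Short exact sequences as triangles, and homotopy pushouts -/

section ShortExact

variable {D : Type*} [Category* D] [HasZeroObject D] [HasShift D ℤ] [Preadditive D]
  [∀ n : ℤ, (shiftFunctor D n).Additive] [Pretriangulated D]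

lemma shortExact_of_distTriang {B : Type*} [Category* B] [Abelian B] {ι : B ⥤ D} [ι.Additive]
    [ι.Full] [ι.Faithful]
    (hι : ∀ ⦃X Y : B⦄ ⦃n : ℤ⦄ (f : ι.obj X ⟶ (ι.obj Y)⟦n⟧), n < 0 → f = 0)
    (S : ShortComplex B) (δ : ι.obj S.X₃ ⟶ (ι.obj S.X₁)⟦(1 : ℤ)⟧)
    (hδ : Triangle.mk (ι.map S.f) (ι.map S.g) δ ∈ distTriang D) : S.ShortExact := by
  have hf := AbelianSubcategory.isLimitKernelForkOfDistTriang hι _ _ _ hδ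
  have hg := AbelianSubcategory.isColimitCokernelCoforkOfDistTriang hι _ _ _ hδ
  exact
    { exact := S.exact_of_f_is_kernel hf
      mono_f := mono_of_isLimit_fork hf
      epi_g := epi_of_isColimit_cofork hg }

lemma heart_detectsShortExact [IsTriangulated D] (t : TStructure D) :
    DetectsShortExact t.heart.ι := by
  intro S
  refine ⟨fun hS ↦ ?_, fun ⟨δ, hδ⟩ ↦ shortExact_of_distTriang (heart_hom_neg t) S δ hδ⟩
  have := hS.epi_g
  obtain ⟨K, i, δ, hδ⟩ := AbelianSubcategory.exists_distinguished_triangle_of_epi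
    (heart_hom_neg t) (heart_admissible t) S.g
  have hi := AbelianSubcategory.isLimitKernelForkOfDistTriang (heart_hom_neg t) _ _ _ hδ
  let e : S.X₁ ≅ K := hS.fIsKernel.conePointUniqueUpToIso hi
  have he : e.hom ≫ i = S.f :=
    hS.fIsKernel.conePointUniqueUpToIso_hom_comp hi WalkingParallelPair.zero
  refine ⟨δ ≫ (t.heart.ι.map e.inv)⟦(1 : ℤ)⟧', isomorphic_distinguished _ hδ _ ?_⟩
  refine Triangle.isoMk _ _ (t.heart.ι.mapIso e) (Iso.refl _) (Iso.refl _) ?_ ?_ ?_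
  · exact (Category.comp_id _).trans ((congrArg t.heart.ι.map he.symm).trans (Functor.map_comp _ _ _))
  · exact (Category.comp_id _).trans (Category.id_comp _).symm
  · refine (Category.assoc _ _ _).trans ?_
    refine Eq.trans ?_ ((Category.comp_id _).trans (Category.id_comp _).symm)
    refine congrArg (δ ≫ ·) ?_
    refine (Functor.map_comp _ _ _).symm.trans ?_
    refine (congrArg (shiftFunctor D (1 : ℤ)).map ((Functor.map_comp _ _ _).symm.trans
      ((congrArg t.heart.ι.map e.inv_hom_id).trans (CategoryTheory.Functor.map_id _ _)))).trans ?_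
    exact CategoryTheory.Functor.map_id _ _

lemma distTriang_of_iso₁ {X Y Z X' : D} {f : X ⟶ Y} {g : Y ⟶ Z} {h : Z ⟶ X⟦(1 : ℤ)⟧}
    (hT : Triangle.mk f g h ∈ distTriang D) (e : X ≅ X') :
    Triangle.mk (e.inv ≫ f) g (h ≫ e.hom⟦(1 : ℤ)⟧') ∈ distTriang D := by
  refine isomorphic_distinguished _ hT _ (Triangle.isoMk _ _ e.symm (Iso.refl _) (Iso.refl _)
    (Category.comp_id _) ((Category.comp_id _).trans (Category.id_comp _).symm) ?_)
  have H : (h ≫ e.hom⟦(1 : ℤ)⟧') ≫ e.inv⟦(1 : ℤ)⟧' = 𝟙 _ ≫ h := by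
    simp [← Functor.map_comp]
  exact H

lemma distTriang_of_iso₂ {X Y Z Y' : D} {f : X ⟶ Y} {g : Y ⟶ Z} {h : Z ⟶ X⟦(1 : ℤ)⟧}
    (hT : Triangle.mk f g h ∈ distTriang D) (e : Y ≅ Y') :
    Triangle.mk (f ≫ e.hom) (e.inv ≫ g) h ∈ distTriang D := by
  have H : (f ≫ e.hom) ≫ e.inv = 𝟙 _ ≫ f := by simp
  have H' : h ≫ (𝟙 X)⟦(1 : ℤ)⟧' = 𝟙 _ ≫ h := by simp
  exact isomorphic_distinguished _ hT _ (Triangle.isoMk _ _ (Iso.refl _) e.symm (Iso.refl _)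
    H (Category.comp_id _) H')

lemma distTriang_of_iso₃ {X Y Z Z' : D} {f : X ⟶ Y} {g : Y ⟶ Z} {h : Z ⟶ X⟦(1 : ℤ)⟧}
    (hT : Triangle.mk f g h ∈ distTriang D) (e : Z ≅ Z') :
    Triangle.mk f (g ≫ e.hom) (e.inv ≫ h) ∈ distTriang D := by
  have H : (g ≫ e.hom) ≫ e.inv = 𝟙 _ ≫ g := by simp
  have H' : (e.inv ≫ h) ≫ (𝟙 X)⟦(1 : ℤ)⟧' = e.inv ≫ h := by simp
  exact isomorphic_distinguished _ hT _ (Triangle.isoMk _ _ (Iso.refl _) (Iso.refl _) e.symm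
    ((Category.comp_id _).trans (Category.id_comp _).symm) H H')

/-- The octahedral axiom for `R[-1] ⟶ P ⟶ P'`: `Q'` is the homotopy pushout of `f` and `p`, and
opposite sides have the same cones. -/
lemma exists_pushout_triangle [IsTriangulated D] {P Q R P' G : D} {f : P ⟶ Q} {g : Q ⟶ R}
    {h : R ⟶ P⟦(1 : ℤ)⟧} (hT : Triangle.mk f g h ∈ distTriang D) {p : P ⟶ P'} {q : P' ⟶ G}
    {r : G ⟶ P⟦(1 : ℤ)⟧} (hT' : Triangle.mk p q r ∈ distTriang D) :
    ∃ (Q' : D) (f' : P' ⟶ Q') (g' : Q' ⟶ R) (h' : R ⟶ P'⟦(1 : ℤ)⟧) (a : Q ⟶ Q') (b : Q' ⟶ G)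
      (c : G ⟶ Q⟦(1 : ℤ)⟧), Triangle.mk f' g' h' ∈ distTriang D ∧
        Triangle.mk a b c ∈ distTriang D := by
  obtain ⟨Q', f', g', hT''⟩ := distinguished_cocone_triangle ((Triangle.mk f g h).invRotate.mor₁ ≫ p)
  have H := (someOctahedron rfl (inv_rot_of_distTriang _ hT) hT' hT'').mem
  exact ⟨Q', _, _, _, _, _, _, distTriang_of_iso₃ (rot_of_distTriang _ hT'')
    ((shiftEquiv D (1 : ℤ)).counitIso.app R), H⟩

end ShortExact

/-! ### Objects of `A` in the derived category -/

section DerivedCategory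

open DerivedCategory

variable {A : Type u} [Category.{v} A] [Abelian A] [HasDerivedCategory.{w} A]

lemma singleFunctor_hom_neg ⦃X Y : A⦄ ⦃n : ℤ⦄
    (f : (singleFunctor A 0).obj X ⟶ ((singleFunctor A 0).obj Y)⟦n⟧) (hn : n < 0) : f = 0 := by
  have := (TStructure.t (C := A)).isGE_shift ((singleFunctor A 0).obj Y) 0 n (-n) (by lia)
  exact (TStructure.t (C := A)).zero f 0 (-n) (by lia)

lemma singleFunctor_detectsShortExact : DetectsShortExact (singleFunctor A 0) :=
  fun S ↦ ⟨fun hS ↦ ⟨hS.singleδ, hS.singleTriangle_distinguished⟩,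
    fun ⟨δ, hδ⟩ ↦ shortExact_of_distTriang singleFunctor_hom_neg S δ hδ⟩

/-- Brutal truncation: for a complex in degrees at most `0`, the top term is a subcomplex, with
quotient in degrees at most `-1`. -/
lemma exists_single_triangle_of_isLE (X : DerivedCategory A) [X.IsLE 0] :
    ∃ (Z : A) (W : DerivedCategory A) (f : (singleFunctor A 0).obj Z ⟶ X) (g : X ⟶ W)
      (h : W ⟶ ((singleFunctor A 0).obj Z)⟦(1 : ℤ)⟧),
      W.IsLE (-1) ∧ Triangle.mk f g h ∈ distTriang _ := by
  obtain ⟨K, _, ⟨e⟩⟩ := X.exists_iso_Q_obj_of_isLE 0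
  have hK (i : ℤ) (hi : 0 < i) : IsZero (K.X i) := K.isZero_of_isStrictlyLE 0 i hi
  let φ : (HomologicalComplex.single A (ComplexShape.up ℤ) 0).obj (K.X 0) ⟶ K :=
    HomologicalComplex.mkHomFromSingle (𝟙 _) (fun k hk ↦ (hK k (by
      rw [ComplexShape.up_Rel] at hk; lia)).eq_of_tgt _ _)
  have hφ : IsIso (φ.f 0) := by
    rw [HomologicalComplex.mkHomFromSingle_f]
    infer_instance
  have : Mono φ := by
    have (i : ℤ) : Mono (φ.f i) := by
      by_cases hi : i = 0
      · subst hi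
        infer_instance
      · exact (HomologicalComplex.isZero_single_obj_X (ComplexShape.up ℤ) 0 (K.X 0) i hi).mono _
    exact HomologicalComplex.mono_of_mono_f φ this
  obtain ⟨S, hS, ψ, hψ, hS₃⟩ : ∃ (S : ShortComplex (CochainComplex A ℤ)) (_ : S.ShortExact)
      (e₁ : S.X₁ ≅ (HomologicalComplex.single A (ComplexShape.up ℤ) 0).obj (K.X 0))
      (_ : S.X₂ ≅ K), CochainComplex.IsStrictlyLE S.X₃ (-1) := by
    let S : ShortComplex (CochainComplex A ℤ) :=
      ShortComplex.mk φ (cokernel.π φ) (cokernel.condition φ)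
    have hS : S.ShortExact := { exact := S.exact_of_g_is_cokernel (cokernelIsCokernel φ) }
    refine ⟨S, hS, Iso.refl _, Iso.refl _, ?_⟩
    rw [CochainComplex.isStrictlyLE_iff]
    intro i hi
    have h := hS.map_of_exact (HomologicalComplex.eval A (ComplexShape.up ℤ) i)
    have h₁ : Epi (φ.f i) := by
      by_cases hi' : i = 0
      · subst hi'
        infer_instance
      · exact IsZero.epi (hK i (by lia)) _
    have h₂ : (cokernel.π φ).f i = 0 := by
      rw [← cancel_epi (φ.f i), ← HomologicalComplex.comp_f, cokernel.condition]
      simp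
    have h₃ : Epi ((cokernel.π φ).f i) := h.epi_g
    rw [h₂] at h₃
    exact @IsZero.of_epi_zero _ _ _ _ _ h₃
  have hT := triangleOfSES_distinguished hS
  let ψ' : Q.obj S.X₁ ≅ (singleFunctor A 0).obj (K.X 0) :=
    Q.mapIso ψ ≪≫ (singleFunctorIsoCompQ A 0).symm.app _
  exact ⟨K.X 0, Q.obj S.X₃, _, _, _, inferInstanceAs ((Q.obj S.X₃).IsLE (-1)),
    distTriang_of_iso₂ (distTriang_of_iso₁ hT ψ') (Q.mapIso hψ ≪≫ e.symm)⟩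

end DerivedCategory

/-! ### Comparison of t-structures and improved truncation triangles -/

section Generation

section Comparison

variable {D : Type*} [Category* D] [HasZeroObject D] [HasShift D ℤ] [Preadditive D]
  [∀ n : ℤ, (shiftFunctor D n).Additive] [Pretriangulated D] {t t' : TStructure D} {a b : ℤ}

lemma isLE_of_le_le (h : t.le a ≤ t'.le b) {X : D} (p q : ℤ) (hpq : p - a = q - b)
    (hX : t.IsLE X p) : t'.IsLE X q := by
  have : t'.IsLE (X⟦p - a⟧) b := ⟨h _ (t.isLE_shift X p (p - a) a (by lia)).le⟩
  exact t'.isLE_of_shift X q (p - a) b (by lia)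

lemma isGE_of_le_le [IsTriangulated D] (h : t.le a ≤ t'.le b) {X : D} (p q : ℤ)
    (hpq : p - a = q - b) (hX : t'.IsGE X q) : t.IsGE X p := by
  rw [t.isGE_iff_orthogonal (p - 1) p (by lia)]
  intro Y f hY
  have := isLE_of_le_le h (p - 1) (q - 1) (by lia) hY
  exact t'.zero f (q - 1) q (by lia)

end Comparison

open DerivedCategory

variable {A : Type u} [Category.{v} A] [Abelian A] [HasDerivedCategory.{w} A]
  {τ : TStructure (DerivedCategory A)} {n : ℕ}

/-- Each step lowers the `τ`-bound on `W` by one. Given `Z ⟶ X ⟶ W`, approximate `W[-1]` by some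
`Z'` in `A`, embed `Z'` in an object of `Y`, and push out twice: first `W[-1]` becomes `W₁`, an
extension of the new `W'` by an object of `Y`, then `Z` becomes `Z₁`, an extension of a cokernel in
`A` by `Z`, hence still in `A`. The new third term is `W₁[1]`, and the shift gains the unit. -/
lemma exists_single_triangle_of_isCogenerating
    (hn : (TStructure.t (C := A)).le (-(n : ℤ)) ≤ τ.le 0)
    (hY : IsCogenerating (interHeart τ)) (m : ℕ) (hm : m ≤ n)
    (X : DerivedCategory A) (hX : X.IsLE 0) :
    ∃ (Z : A) (W : DerivedCategory A) (f : (singleFunctor A 0).obj Z ⟶ X) (g : X ⟶ W)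
      (h : W ⟶ ((singleFunctor A 0).obj Z)⟦(1 : ℤ)⟧),
      W.IsLE (-1) ∧ τ.IsLE W (n - 1 - m) ∧ Triangle.mk f g h ∈ distTriang _ := by
  induction m generalizing X with
  | zero =>
    obtain ⟨Z, W, f, g, h, hW, hT⟩ := exists_single_triangle_of_isLE X
    exact ⟨Z, W, f, g, h, hW, isLE_of_le_le hn (-1) _ (by lia) hW, hT⟩
  | succ m hm' =>
    obtain ⟨Z, W, f, g, h, hW, hW', hT⟩ := hm' (by lia) X hX
    have hW₀ : (W⟦(-1 : ℤ)⟧).IsLE 0 := TStructure.t.isLE_shift W (-1) (-1) 0 (by lia)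
    obtain ⟨Z', W', f', g', h', hW'₁, hW'₂, hT'⟩ := hm' (by lia) (W⟦(-1 : ℤ)⟧) hW₀
    obtain ⟨Y, hY', i, _⟩ := hY Z'
    let S := ShortComplex.mk i (cokernel.π i) (cokernel.condition i)
    have hS : S.ShortExact := { exact := S.exact_of_g_is_cokernel (cokernelIsCokernel i) }
    obtain ⟨W₁, _, _, _, _, _, _, hT₁, hT₂⟩ :=
      exists_pushout_triangle hT' hS.singleTriangle_distinguished
    obtain ⟨Z₁, _, _, _, _, _, _, hT₃, hT₄⟩ :=
      exists_pushout_triangle (inv_rot_of_distTriang _ hT) hT₂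
    have hW₁ : W₁.IsLE 0 := TStructure.t.isLE₂ _ hT₂ 0 hW₀
      (inferInstanceAs (IsLE ((singleFunctor A 0).obj S.X₃) 0))
    have hW₁' : τ.IsLE W₁ (n - 1 - m) := by
      have h₁ : τ.IsLE ((singleFunctor A 0).obj Y) 0 := ((τ.mem_heart_iff _).1 hY').1
      -- Here `m + 1 ≤ n` is needed, so that `0 ≤ n - 1 - m`.
      exact τ.isLE₂ _ hT₁ _ (τ.isLE_of_le ((singleFunctor A 0).obj Y) 0 _ (by lia)) hW'₂
    have : Z₁.IsLE 0 := TStructure.t.isLE₂ _ hT₄ 0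
      (inferInstanceAs (IsLE ((singleFunctor A 0).obj Z) 0))
      (inferInstanceAs (IsLE ((singleFunctor A 0).obj S.X₃) 0))
    have : Z₁.IsGE 0 := TStructure.t.isGE₂ _ hT₄ 0
      (inferInstanceAs (IsGE ((singleFunctor A 0).obj Z) 0))
      (inferInstanceAs (IsGE ((singleFunctor A 0).obj S.X₃) 0))
    obtain ⟨Z₂, ⟨e⟩⟩ := exists_iso_singleFunctor_obj_of_isGE_of_isLE Z₁ 0
    exact ⟨Z₂, W₁⟦(1 : ℤ)⟧, _, _, _, TStructure.t.isLE_shift W₁ 0 1 (-1) (by lia),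
      τ.isLE_shift W₁ (n - 1 - m) 1 _ (by push_cast; lia),
      distTriang_of_iso₁ (rot_of_distTriang _ hT₃) e⟩

end Generation

/-! ### The class `Y` inside `A` and inside the heart -/

section InterHeart

open DerivedCategory

variable {A : Type u} [Category.{v} A] [Abelian A] [HasDerivedCategory.{w} A]
  (τ : TStructure (DerivedCategory A)) {n : ℕ}

instance interHeart_closedUnderIsomorphisms : (interHeart τ).IsClosedUnderIsomorphisms where
  of_iso e h := τ.heart.prop_of_iso ((singleFunctor A 0).mapIso e) h

instance interHeart_containsZero : (interHeart τ).ContainsZero where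
  exists_zero := by
    obtain ⟨Z, hZ⟩ := HasZeroObject.zero (C := A)
    have := (singleFunctor A 0).map_isZero hZ
    exact ⟨Z, hZ, (τ.mem_heart_iff _).2 ⟨τ.isLE_of_isZero this 0, τ.isGE_of_isZero this 0⟩⟩

instance interHeart_closedUnderBinaryProducts : (interHeart τ).IsClosedUnderBinaryProducts where
  limitsOfShape_le := by
    rintro X ⟨p⟩
    have H : τ.heart.IsClosedUnderBinaryProducts := inferInstance
    exact H.limitsOfShape_le _ ⟨{
      diag := p.diag ⋙ singleFunctor A 0
      π := _
      isLimit := isLimitOfPreserves (singleFunctor A 0) p.isLimit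
      prop_diag_obj := p.prop_diag_obj }⟩

instance interHeart_closedUnderFiniteProducts :
    (interHeart τ).IsClosedUnderFiniteProducts := .mk'

instance : HasBinaryBiproducts (interHeart τ).FullSubcategory :=
  HasBinaryBiproducts.of_hasBinaryProducts

/-- The inclusion of `A ∩ H_τ` into the heart. -/
noncomputable def interHeartToHeart : (interHeart τ).FullSubcategory ⥤ τ.heart.FullSubcategory :=
  τ.heart.lift ((interHeart τ).ι ⋙ singleFunctor A 0) (fun X ↦ X.property)

/-- Objects of `A ∩ H_τ` have the same image in the derived category via `A` and via the heart. -/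
noncomputable def interHeartToHeartCompι :
    (interHeart τ).ι ⋙ singleFunctor A 0 ≅ interHeartToHeart τ ⋙ τ.heart.ι :=
  (τ.heart.liftCompιIso _ _).symm

instance : (interHeartToHeart τ).Full where
  map_surjective f := by
    obtain ⟨g, hg⟩ := ((interHeart τ).ι ⋙ singleFunctor A 0).map_surjective f.hom
    exact ⟨g, τ.heart.ι.map_injective hg⟩

instance : (interHeartToHeart τ).Faithful where
  map_injective h := ((interHeart τ).ι ⋙ singleFunctor A 0).map_injective
    (congrArg τ.heart.ι.map h)

instance : (interHeartToHeart τ).Additive where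
  map_add := τ.heart.ι.map_injective ((singleFunctor A 0).map_add)

variable {τ}

lemma coresolutionDimension (hn : (TStructure.t (C := A)).le (-(n : ℤ)) ≤ τ.le 0)
    (h₀ : τ.le 0 ≤ (TStructure.t (C := A)).le 0) (hY : IsCogenerating (interHeart τ)) :
    CoresolutionDimension (interHeart τ).ι
      (fun k X ↦ τ.IsLE ((singleFunctor A 0).obj X) k) n where
  zero_le X hX := ⟨⟨X, (τ.mem_heart_iff _).2 ⟨hX, isGE_of_le_le h₀ 0 0 (by lia)
    (inferInstanceAs (((singleFunctor A 0).obj X).IsGE 0))⟩⟩, ⟨Iso.refl _⟩⟩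
  step k S hS h₂ h₁ := by
    obtain ⟨Y, ⟨e⟩⟩ := h₂
    have hY : τ.IsLE ((singleFunctor A 0).obj Y.obj) 0 := ((τ.mem_heart_iff _).1 Y.property).1
    have : τ.IsLE ((singleFunctor A 0).obj S.X₂) 0 :=
      @TStructure.isLE_of_iso _ _ _ _ _ _ _ τ _ _ ((singleFunctor A 0).mapIso e) 0 hY
    exact τ.isLE₂ _ (rot_of_distTriang _ hS.singleTriangle_distinguished) k
      (τ.isLE_of_le ((singleFunctor A 0).obj S.X₂) 0 k (by lia))
      (@TStructure.isLE_shift _ _ _ _ _ _ _ τ _ (k + 1 : ℕ) 1 k (by push_cast; lia) h₁)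
  top X := isLE_of_le_le hn 0 n (by lia) (inferInstanceAs (((singleFunctor A 0).obj X).IsLE 0))
  mono X := by
    obtain ⟨Y, hY, i, hi⟩ := hY X
    exact ⟨⟨Y, hY⟩, i, hi⟩

/-- At `m = n` the third term `W` is in `τ`-degrees at most `-1`. Then `Z`, an extension of `X` by
`W[-1]`, is in the heart, and `W[-1]` is the kernel of `Z ⟶ X`. -/
lemma exists_epi_interHeartToHeart (hn : (TStructure.t (C := A)).le (-(n : ℤ)) ≤ τ.le 0)
    (h₀ : τ.le 0 ≤ (TStructure.t (C := A)).le 0) (hY : IsCogenerating (interHeart τ))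
    (X : τ.heart.FullSubcategory) :
    ∃ (Y : (interHeart τ).FullSubcategory) (p : (interHeartToHeart τ).obj Y ⟶ X), Epi p := by
  have hX := (τ.mem_heart_iff _).1 X.property
  have h₁ : τ.IsLE X.obj 0 := hX.1
  have h₂ : τ.IsGE X.obj 0 := hX.2
  obtain ⟨Z, W, f, g, h, hW, hW', hT⟩ := exists_single_triangle_of_isCogenerating hn hY n le_rfl
    X.obj (isLE_of_le_le h₀ 0 0 (by lia) h₁)
  have hW₀ : τ.IsLE W (-1) := by simpa using hW'
  have hW₁ : τ.IsLE (W⟦(-1 : ℤ)⟧) 0 := τ.isLE_shift W (-1) (-1) 0 (by lia)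
  have hZ : τ.IsGE ((singleFunctor A 0).obj Z) 0 := isGE_of_le_le h₀ 0 0 (by lia)
    (inferInstanceAs (((singleFunctor A 0).obj Z).IsGE 0))
  have hT₁ := inv_rot_of_distTriang _ hT
  have hT₂ := inv_rot_of_distTriang _ hT₁
  have hW₂ : τ.IsGE (W⟦(-1 : ℤ)⟧) 0 := τ.isGE₂ _ hT₂ 0
    (@TStructure.isGE_of_ge _ _ _ _ _ _ _ τ _ 0 1 (by lia) (τ.isGE_shift X.obj 0 (-1) 1 (by lia))) hZ
  have hZ' : τ.IsLE ((singleFunctor A 0).obj Z) 0 := τ.isLE₂ _ hT₁ 0 hW₁ h₁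
  let Y : (interHeart τ).FullSubcategory := ⟨Z, (τ.mem_heart_iff _).2 ⟨hZ', hZ⟩⟩
  let K : τ.heart.FullSubcategory := ⟨W⟦(-1 : ℤ)⟧, (τ.mem_heart_iff _).2 ⟨hW₁, hW₂⟩⟩
  let a : K ⟶ (interHeartToHeart τ).obj Y := ⟨(Triangle.mk f g h).invRotate.mor₁⟩
  let p : (interHeartToHeart τ).obj Y ⟶ X := ⟨f⟩
  have hap : a ≫ p = 0 := τ.heart.ι.map_injective (comp_distTriang_mor_zero₁₂ _ hT₁)
  exact ⟨Y, p, ((heart_detectsShortExact τ (ShortComplex.mk a p hap)).2 ⟨_, hT₁⟩).epi_g⟩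

lemma resolutionDimension (hn : (TStructure.t (C := A)).le (-(n : ℤ)) ≤ τ.le 0)
    (h₀ : τ.le 0 ≤ (TStructure.t (C := A)).le 0) (hY : IsCogenerating (interHeart τ)) :
    ResolutionDimension (interHeartToHeart τ) (fun k X ↦ X.obj.IsGE (-k)) n where
  zero_le X hX := by
    have h₁ : X.obj.IsLE 0 := isLE_of_le_le h₀ 0 0 (by lia) ((τ.mem_heart_iff _).1 X.property).1
    have h₂ : X.obj.IsGE 0 := hX
    obtain ⟨Z, ⟨e⟩⟩ := exists_iso_singleFunctor_obj_of_isGE_of_isLE X.obj 0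
    exact ⟨⟨Z, τ.heart.prop_of_iso e X.property⟩, ⟨τ.heart.isoMk e.symm⟩⟩
  step k S hS h₂ h₃ := by
    obtain ⟨δ, hδ⟩ := (heart_detectsShortExact τ S).1 hS
    obtain ⟨Y, ⟨e⟩⟩ := h₂
    have hY : S.X₂.obj.IsGE 0 := @TStructure.isGE_of_iso _ _ _ _ _ _ _ TStructure.t _ _
      (τ.heart.ι.mapIso e) 0 (inferInstanceAs (((singleFunctor A 0).obj Y.obj).IsGE 0))
    exact TStructure.t.isGE₂ _ (inv_rot_of_distTriang _ hδ) (-k)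
      (@TStructure.isGE_shift _ _ _ _ _ _ _ TStructure.t _ (-(k + 1 : ℕ)) (-1) (-k)
        (by push_cast; lia) h₃)
      (TStructure.t.isGE_of_ge S.X₂.obj (-k) 0 (by lia))
  top X := isGE_of_le_le hn (-n) 0 (by lia) ((τ.mem_heart_iff _).1 X.property).2
  epi X := exists_epi_interHeartToHeart hn h₀ hY X

end InterHeart

/-! ### Uniqueness of triangulated localizations -/

section Uniqueness

variable {C D D' : Type*} [Category* C] [Category* D] [Category* D']
  [HasZeroObject C] [HasShift C ℤ] [Preadditive C] [∀ n : ℤ, (shiftFunctor C n).Additive]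
  [Pretriangulated C] [IsTriangulated C]
  [HasZeroObject D] [HasShift D ℤ] [Preadditive D] [∀ n : ℤ, (shiftFunctor D n).Additive]
  [Pretriangulated D]
  [HasZeroObject D'] [HasShift D' ℤ] [Preadditive D'] [∀ n : ℤ, (shiftFunctor D' n).Additive]
  [Pretriangulated D']
  (L : C ⥤ D) [L.CommShift ℤ] [L.IsTriangulated] (L' : C ⥤ D') [L'.CommShift ℤ]
  [L'.IsTriangulated] (N : ObjectProperty C) [N.IsTriangulated]

lemma exists_triangulated_equivalence_of_isLocalization [L.IsLocalization N.trW]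
    [L'.IsLocalization N.trW] :
    ∃ (E : D ≌ D') (_ : E.functor.CommShift ℤ), E.functor.IsTriangulated ∧
      Nonempty (L ⋙ E.functor ≅ L') := by
  let E := Localization.uniq L L' N.trW
  let hE : E.functor.CommShift ℤ := Functor.commShiftOfLocalization L N.trW ℤ L' E.functor
  have := Localization.essSurj_mapArrow L N.trW
  have : NatTrans.CommShift (Localization.Lifting.iso L N.trW L' E.functor).hom ℤ :=
    NatTrans.commShift_iso_hom_of_localization L N.trW ℤ L' E.functor
  exact ⟨E, hE, Functor.isTriangulated_of_precomp_iso
    (Localization.Lifting.iso L N.trW L' E.functor), ⟨Localization.compUniqFunctor L L' N.trW⟩⟩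

end Uniqueness

/-! ### The derived equivalence -/

section DerivedEquivalence

open DerivedCategory

variable {Y : Type*} [Category* Y] [Preadditive Y]

/-- The functor induced by an additive functor on homotopy categories is compatible with the
functors that view an object as a complex concentrated in degree zero. -/
noncomputable def singleCompMapHomotopyCategoryCompQh [HasZeroObject Y] {B : Type*} [Category* B] [Abelian B]
    [HasDerivedCategory.{w} B] (j : Y ⥤ B) [j.Additive] :
    (HomologicalComplex.single Y (ComplexShape.up ℤ) 0 ⋙ HomotopyCategory.quotient Y _) ⋙
      j.mapHomotopyCategory _ ⋙ Qh ≅ j ⋙ singleFunctor B 0 :=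
  Functor.isoWhiskerRight (Functor.isoWhiskerLeft (HomologicalComplex.single Y _ 0)
      (j.mapHomotopyCategoryFactors _)) Qh ≪≫
    Functor.isoWhiskerRight (HomologicalComplex.singleMapHomologicalComplex j _ 0)
      (HomotopyCategory.quotient B _ ⋙ Qh)

variable {B B' : Type*} [Category* B] [Abelian B] [Category* B'] [Abelian B']
  {D : Type*} [Category* D] [HasZeroObject D] [HasShift D ℤ] [Preadditive D]
  [∀ n : ℤ, (shiftFunctor D n).Additive] [Pretriangulated D]
  {ι : B ⥤ D} {ι' : B' ⥤ D} (hι : DetectsShortExact ι) (hι' : DetectsShortExact ι')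
  {j : Y ⥤ B} {j' : Y ⥤ B'} [j.Additive] [j'.Additive] [j.Full] [j.Faithful] [j'.Full] [j'.Faithful]
  (e : j ⋙ ι ≅ j' ⋙ ι') {dim : ℕ → ObjectProperty B} {dim' : ℕ → ObjectProperty B'} {n : ℕ}

include hι hι' e

lemma inverseImage_subcategoryAcyclic_eq (H : CoresolutionDimension j dim n)
    (H' : ResolutionDimension j' dim' n) :
    (HomotopyCategory.subcategoryAcyclic B).inverseImage (j.mapHomotopyCategory _) =
      (HomotopyCategory.subcategoryAcyclic B').inverseImage (j'.mapHomotopyCategory _) := by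
  ext K
  obtain ⟨K, rfl⟩ := HomotopyCategory.quotient_obj_surjective K
  refine Iff.trans (HomotopyCategory.quotient_obj_mem_subcategoryAcyclic_iff_acyclic
    ((j.mapHomologicalComplex _).obj K)) (Iff.trans ?_
    (HomotopyCategory.quotient_obj_mem_subcategoryAcyclic_iff_acyclic
      ((j'.mapHomologicalComplex _).obj K)).symm)
  exact ⟨H.acyclic_map hι hι' e K, H'.acyclic_map hι' hι e.symm K⟩

lemma exists_derived_equivalence [HasZeroObject Y] [HasBinaryBiproducts Y]
    [HasDerivedCategory.{w} B] [HasDerivedCategory.{w'} B'] (H : CoresolutionDimension j dim n)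
    (H' : ResolutionDimension j' dim' n) :
    ∃ (E : DerivedCategory B' ≌ DerivedCategory B) (_ : E.functor.CommShift ℤ),
      E.functor.IsTriangulated ∧
        Nonempty (j' ⋙ singleFunctor B' 0 ⋙ E.functor ≅ j ⋙ singleFunctor B 0) := by
  have h₁ := isLocalization_comp_of_right_resolutions (j.mapHomotopyCategory (ComplexShape.up ℤ))
    (HomotopyCategory.subcategoryAcyclic B) Qh (fun K ↦ H.exists_trW K)
  have h₂ := isLocalization_comp_of_left_resolutions (j'.mapHomotopyCategory (ComplexShape.up ℤ))
    (HomotopyCategory.subcategoryAcyclic B') Qh (fun K ↦ H'.exists_trW K)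
  rw [inverseImage_subcategoryAcyclic_eq hι hι' e H H'] at h₁
  obtain ⟨E, hE, hE', ⟨iso⟩⟩ := exists_triangulated_equivalence_of_isLocalization
    (j'.mapHomotopyCategory (ComplexShape.up ℤ) ⋙ Qh)
    (j.mapHomotopyCategory (ComplexShape.up ℤ) ⋙ Qh)
    ((HomotopyCategory.subcategoryAcyclic B').inverseImage (j'.mapHomotopyCategory _))
  exact ⟨E, hE, hE', ⟨
    Functor.isoWhiskerRight (singleCompMapHomotopyCategoryCompQh j').symm E.functor ≪≫
    Functor.isoWhiskerLeft (HomologicalComplex.single Y (ComplexShape.up ℤ) 0 ⋙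
      HomotopyCategory.quotient Y _) iso ≪≫ singleCompMapHomotopyCategoryCompQh j⟩⟩

end DerivedEquivalence

/-! ### Extending the natural isomorphism from `Y` to the heart -/

section Extension

variable {Y B D : Type*} [Category* Y] [Category* B] [Category* D]
  {j : Y ⥤ B} {F ι : B ⥤ D} (θ : j ⋙ F ≅ j ⋙ ι)

/-- `F.map p` need not be epi in `D`, but against targets `ι.obj Z` it can be cancelled: `e` and
full faithfulness of `ι` bring the question back to `p` in `B`. -/
lemma map_cancel_epi [ι.Full] [ι.Faithful] {X : B} {M : Y} (p : j.obj M ⟶ X) [Epi p]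
    (e : F.obj X ≅ ι.obj X) (he : F.map p ≫ e.hom = θ.hom.app M ≫ ι.map p) {Z : B}
    {g g' : F.obj X ⟶ ι.obj Z} (h : F.map p ≫ g = F.map p ≫ g') : g = g' := by
  have hp : F.map p = θ.hom.app M ≫ ι.map p ≫ e.inv := by
    rw [← Category.assoc, Iso.eq_comp_inv]
    exact he
  obtain ⟨a, ha⟩ := ι.map_surjective (e.inv ≫ g)
  obtain ⟨a', ha'⟩ := ι.map_surjective (e.inv ≫ g')
  rw [hp, Category.assoc, Category.assoc, Category.assoc, Category.assoc,
    cancel_epi (θ.hom.app M), ← ha, ← ha', ← ι.map_comp, ← ι.map_comp] at h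
  have := (cancel_epi p).1 (ι.map_injective h)
  rw [← cancel_epi e.inv, ← ha, ← ha', this]

/-- Isomorphisms `F.obj X ≅ ι.obj X` that are compatible with a given isomorphism of functors
`j ⋙ F ≅ j ⋙ ι`. -/
def IsoExtends (X : B) : Prop :=
  ∃ e : F.obj X ≅ ι.obj X, ∀ ⦃M : Y⦄ (p : j.obj M ⟶ X),
    F.map p ≫ e.hom = θ.hom.app M ≫ ι.map p

lemma isoExtends_of_essImage [j.Full] {X : B} (hX : j.essImage X) : IsoExtends θ X := by
  obtain ⟨M, ⟨i⟩⟩ := hX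
  refine ⟨F.mapIso i.symm ≪≫ θ.app M ≪≫ ι.mapIso i, fun N p ↦ ?_⟩
  obtain ⟨f, hf⟩ := j.map_surjective (p ≫ i.inv)
  have := θ.hom.naturality f
  simp only [Functor.comp_map, hf, Functor.map_comp] at this
  simp only [Iso.trans_hom, Functor.mapIso_hom, Iso.symm_hom, Iso.app_hom]
  rw [← Category.assoc, ← Category.assoc, this, Category.assoc, Category.assoc,
    ← ι.map_comp, i.inv_hom_id, ι.map_id, Category.comp_id]

variable [Abelian B] [HasZeroObject D] [HasShift D ℤ] [Preadditive D]
  [∀ n : ℤ, (shiftFunctor D n).Additive] [Pretriangulated D]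
  (hF : ∀ S : ShortComplex B, S.ShortExact → ∃ δ : F.obj S.X₃ ⟶ (F.obj S.X₁)⟦(1 : ℤ)⟧,
    Triangle.mk (F.map S.f) (F.map S.g) δ ∈ distTriang D)
  (hι : ∀ S : ShortComplex B, S.ShortExact → ∃ δ : ι.obj S.X₃ ⟶ (ι.obj S.X₁)⟦(1 : ℤ)⟧,
    Triangle.mk (ι.map S.f) (ι.map S.g) δ ∈ distTriang D)
  [j.Full] [ι.Full] [ι.Faithful]

include θ hF hι

lemma isoExtends_of_shortExact (hj : ∀ X : B, ∃ (M : Y) (p : j.obj M ⟶ X), Epi p) {M : Y}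
    {K X : B} (k : K ⟶ j.obj M) (p : j.obj M ⟶ X) (w : k ≫ p = 0)
    (hS : (ShortComplex.mk k p w).ShortExact) (hK : IsoExtends θ K) : IsoExtends θ X := by
  obtain ⟨e, he⟩ := hK
  have := hS.epi_g
  obtain ⟨δ, hδ⟩ := hF _ hS
  obtain ⟨δ', hδ'⟩ := hι _ hS
  have nat {N N' : Y} (f : j.obj N ⟶ j.obj N') :
      F.map f ≫ θ.hom.app N' = θ.hom.app N ≫ ι.map f := by
    obtain ⟨f, rfl⟩ := j.map_surjective f
    exact θ.hom.naturality f
  have comm : F.map k ≫ θ.hom.app M = e.hom ≫ ι.map k := by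
    obtain ⟨N, q, _⟩ := hj K
    refine map_cancel_epi θ q e (he q) ?_
    rw [← Category.assoc, ← F.map_comp, nat, ← Category.assoc, he, Category.assoc, ι.map_comp]
  -- The axiom gives some filler `c`, compatible with `p` only; the pullback argument below extends
  -- this to every `y`.
  obtain ⟨(c : F.obj X ⟶ ι.obj X), hc, hc'⟩ := complete_distinguished_triangle_morphism _ _ hδ hδ' e.hom
    (θ.hom.app M) comm
  have hc₀ : F.map p ≫ c = θ.hom.app M ≫ ι.map p := hc
  let φ : Triangle.mk (F.map k) (F.map p) δ ⟶ Triangle.mk (ι.map k) (ι.map p) δ' :=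
    { hom₁ := e.hom, hom₂ := θ.hom.app M, hom₃ := c, comm₁ := comm, comm₂ := hc, comm₃ := hc' }
  have : IsIso c := isIso₃_of_isIso₁₂ φ hδ hδ' (inferInstanceAs (IsIso e.hom))
    (inferInstanceAs (IsIso (θ.hom.app M)))
  refine ⟨asIso c, fun N y ↦ ?_⟩
  -- As `p` is epi, so is `pullback.fst y p`; hence `N'` covers `N`, and over `N'` the map `y`
  -- factors through `p`.
  obtain ⟨N', q, _⟩ := hj (pullback y p)
  refine map_cancel_epi θ (q ≫ pullback.fst y p) (θ.app N) (nat _) (Z := X) ?_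
  calc F.map (q ≫ pullback.fst y p) ≫ F.map y ≫ c
    _ = F.map ((q ≫ pullback.snd y p) ≫ p) ≫ c := by
      rw [← Category.assoc, ← F.map_comp, Category.assoc, Category.assoc, pullback.condition]
    _ = θ.hom.app N' ≫ ι.map ((q ≫ pullback.snd y p) ≫ p) := by
      rw [F.map_comp, Category.assoc, hc₀, ← Category.assoc, nat, Category.assoc, ← ι.map_comp]
    _ = θ.hom.app N' ≫ ι.map ((q ≫ pullback.fst y p) ≫ y) := by
      rw [Category.assoc, Category.assoc, pullback.condition]
    _ = F.map (q ≫ pullback.fst y p) ≫ θ.hom.app N ≫ ι.map y := by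
      rw [ι.map_comp, ← Category.assoc, ← nat, Category.assoc]

lemma nonempty_iso_of_resolutionDimension [Preadditive Y] [j.Additive]
    {dim : ℕ → ObjectProperty B} {n : ℕ} (H : ResolutionDimension j dim n) :
    Nonempty (F ≅ ι) := by
  have h (k : ℕ) : ∀ X : B, dim k X → IsoExtends θ X := by
    induction k with
    | zero => exact fun X hX ↦ isoExtends_of_essImage θ (H.zero_le _ hX)
    | succ k hk =>
      intro X hX
      obtain ⟨M, p, _⟩ := H.epi X
      let S := ShortComplex.mk (kernel.ι p) p (kernel.condition p)
      have hS : S.ShortExact := { exact := S.exact_of_f_is_kernel (kernelIsKernel p) }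
      exact isoExtends_of_shortExact θ hF hι H.epi _ p (kernel.condition p) hS
        (hk _ (H.step k S hS (j.obj_mem_essImage M) hX))
  choose e he using fun X ↦ h n X (H.top X)
  refine ⟨NatIso.ofComponents e fun {X X'} f ↦ ?_⟩
  obtain ⟨M, p, _⟩ := H.epi X
  refine map_cancel_epi θ p (e X) (he X p) ?_
  rw [← Category.assoc, ← F.map_comp, he, ← Category.assoc, he, Category.assoc, ι.map_comp]

end Extension

end TiltingHeart

theorem theorem1p8 {A : Type u} [Category.{v} A] [Abelian A] [HasDerivedCategory.{w} A]
    (τ : TStructure (DerivedCategory A))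
    [HasDerivedCategory.{w'} τ.heart.FullSubcategory]
    (n : ℕ)
    (hn : (DerivedCategory.TStructure.t (C := A)).le (-(n : ℤ)) ≤ τ.le 0)
    (h₀ : τ.le 0 ≤ (DerivedCategory.TStructure.t (C := A)).le 0)
    (hY : TiltingHeart.IsCogenerating (TiltingHeart.interHeart τ)) :
    ∃ (E : DerivedCategory τ.heart.FullSubcategory ≌ DerivedCategory A)
      (_ : E.functor.CommShift ℤ),
      E.functor.IsTriangulated ∧
      Nonempty (DerivedCategory.singleFunctor τ.heart.FullSubcategory 0 ⋙ E.functor ≅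
        τ.heart.ι) := by
  have hH := TiltingHeart.resolutionDimension hn h₀ hY
  have hι := TiltingHeart.heart_detectsShortExact τ
  let e := TiltingHeart.interHeartToHeartCompι τ
  obtain ⟨E, hE, hE', ⟨iso⟩⟩ := TiltingHeart.exists_derived_equivalence
    TiltingHeart.singleFunctor_detectsShortExact hι e
    (TiltingHeart.coresolutionDimension hn h₀ hY) hH
  refine ⟨E, hE, hE', TiltingHeart.nonempty_iso_of_resolutionDimension
    (j := TiltingHeart.interHeartToHeart τ) (iso ≪≫ e) (fun S hS ↦ ?_) (fun S ↦ (hι S).1) hH⟩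
  exact ⟨_, E.functor.map_distinguished _ hS.singleTriangle_distinguished⟩
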